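/- Let $X$ be a set, let $P=\mathcal{GP}(m,K)$ be (the law on $\mathbb R^X$, with the product $\sigma$-algebra, of) a Gaussian process with mean function $m:X\to\mathbb R$ and covariance kernel $K:X\times X\to\mathbb R$, and let $z_1,\dots,z_M\in X$ be such that the matrix $K_{MM}=(K(z_i,z_j))_{i,j=1}^M$ is positive definite. Write $f_M=(f(z_1),\dots,f(z_M))$, $m_M=(m(z_1),\dots,m(z_M))$ and $k_M(x)=(K(x,z_1),\dots,K(x,z_M))$. There is exactly one regular conditional distribution $y\mapsto P(f\mid f_M=y)$ of $f$ given $f_M$ under $P$ whose finite-dimensional marginals depend weakly continuously on $y\in\mathbb R^M$. Let $a_M\in\mathbb R^M$, let $B_{MM}\in\mathbb R^{M\times M}$ be symmetric positive semidefinite, and let $Q=\int P(f\mid f_M=y)\,d\mathcal N(y\mid a_M,B_{MM})$, i.e. the Gaussian $\mathcal N(a_M,B_{MM})$ on the values at $z_1,\dots,z_M$ is extended to all of $X$ by the prior conditional. Then $Q$ is the Gaussian process with mean function $m(x)+k_M(x)K_{MM}^{-1}(a_M-m_M)$ and covariance kernel $K(x,x')-k_M(x)K_{MM}^{-1}(K_{MM}-B_{MM})K_{MM}^{-1}k_M(x')^T$;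 moreover $P(f_M)=\mathcal N(m_M,K_{MM})$, $Q(f_M)=\mathcal N(a_M,B_{MM})$, and $$KL(Q\|P)=KL\big(Q(f_M)\,\|\,P(f_M)\big).$$ If $B_{MM}$ is positive definite, this number is finite and equals $$-\tfrac12\ln\det\big[B_{MM}K_{MM}^{-1}\big]+\tfrac12\operatorname{tr}\big[B_{MM}K_{MM}^{-1}\big]-\tfrac M2+\tfrac12(a_M-m_M)^TK_{MM}^{-1}(a_M-m_M);$$ if $B_{MM}$ is singular, it is $+\infty$. -/

import Mathlib

open MeasureTheory ProbabilityTheory Matrix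
open scoped ENNReal BoundedContinuousFunction

namespace SparseGP

variable {X : Type*}

/-- `P`, a measure on the function space `X → ℝ` with its product σ-algebra, is the law
`GP(m, K)` of a Gaussian process with mean function `m` and covariance kernel `K`.
(The Gaussianity of the finite-dimensional marginals makes `P` a probability measure and all
coordinates square-integrable, and forces `K` to be symmetric positive semidefinite.) -/
structure IsGPLaw (m : X → ℝ) (K : X → X → ℝ) (P : Measure (X → ℝ)) : Prop where
  gaussian : IsGaussianProcess (fun (x : X) (f : X → ℝ) => f x) P
  mean : ∀ x, ∫ f, f x ∂P = m x
  cov : ∀ x x', covariance (fun f : X → ℝ => f x) (fun f : X → ℝ => f x') P = K x x'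

/-- The vector of function values `f_M = (f (z 1), …, f (z M))`. -/
noncomputable def evalAt {M : ℕ} (z : Fin M → X) (f : X → ℝ) : EuclideanSpace ℝ (Fin M) :=
  WithLp.toLp 2 (fun i => f (z i))

/-- The kernel matrix `K_MM = (K (z i) (z j))`. -/
def gram (K : X → X → ℝ) {M : ℕ} (z : Fin M → X) : Matrix (Fin M) (Fin M) ℝ :=
  Matrix.of fun i j => K (z i) (z j)

/-- The vector `k_M(x) = (K x (z 1), …, K x (z M))`. -/
def kvec (K : X → X → ℝ) {M : ℕ} (z : Fin M → X) (x : X) : Fin M → ℝ :=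
  fun i => K x (z i)

/-- `κ` is the conditional distribution `P(f | f_M)`: a Markov kernel which disintegrates the joint
law of `(f_M, f)` under `P`, in its version depending continuously on the conditioning value `y`
(weak continuity of all finite-dimensional marginals), so that `κ y = P(f | f_M = y)` is
meaningful for every single `y`, and not only for almost every `y`. -/
structure IsConditional (P : Measure (X → ℝ)) {M : ℕ} (z : Fin M → X)
    (κ : Kernel (EuclideanSpace ℝ (Fin M)) (X → ℝ)) : Prop where
  markov : IsMarkovKernel κ
  disintegrate : (P.map (evalAt z)).compProd κ = P.map (fun f => (evalAt z f, f))
  continuous : ∀ (n : ℕ) (x : Fin n → X) (φ : EuclideanSpace ℝ (Fin n) →ᵇ ℝ),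
    Continuous fun y => ∫ f, φ (evalAt x f) ∂(κ y)

/-- The law `Q(f) = ∫ κ(f | f_M) dN(f_M | a, B)`: draw `f_M` from `N(a, B)`, then `f` from the
conditional distribution `κ` given `f_M`. -/
noncomputable def extend {M : ℕ} (κ : Kernel (EuclideanSpace ℝ (Fin M)) (X → ℝ))
    (a : EuclideanSpace ℝ (Fin M)) (B : Matrix (Fin M) (Fin M) ℝ) : Measure (X → ℝ) :=
  (multivariateGaussian a B).bind κ

/-- `m(x) + k_M(x) K_MM⁻¹ (a - m_M)`. -/
noncomputable def postMean (m : X → ℝ) (K : X → X → ℝ) {M : ℕ} (z : Fin M → X)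
    (a : EuclideanSpace ℝ (Fin M)) (x : X) : ℝ :=
  m x + kvec K z x ⬝ᵥ ((gram K z)⁻¹ *ᵥ (a - evalAt z m).ofLp)

/-- `K(x, x') - k_M(x) K_MM⁻¹ (K_MM - B) K_MM⁻¹ k_M(x')ᵀ`. -/
noncomputable def postCov (K : X → X → ℝ) {M : ℕ} (z : Fin M → X)
    (B : Matrix (Fin M) (Fin M) ℝ) (x x' : X) : ℝ :=
  K x x' - kvec K z x ⬝ᵥ (((gram K z)⁻¹ * (gram K z - B) * (gram K z)⁻¹) *ᵥ kvec K z x')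

end SparseGP

/-! Everything rests on regression. With weights w(x) = k_M(x) K_MM⁻¹, split f(x) = r(x) + w(x)·f_M.
The residual r is uncorrelated with f_M and jointly Gaussian with it, hence independent
(`IsGPLaw.indepFun_evalAt_residual`). So conditioning on f_M = y replaces f_M by y and leaves the
law of r alone: the law of r + w·y is a conditional distribution, and it is weakly continuous in y.
It is the only such version: two versions agree for almost every y, and N(m_M, K_MM) charges every
open set, so continuity forces agreement at every y (`IsConditional.unique`).

Consequently Q is the law of r + w·Y with Y ~ N(a, B) independent of r (`extend_conditional`). It is
Gaussian, and its mean and covariance are the sums of those of the two parts.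

For the divergence, P and Q arise from their f_M-marginals through one and the same kernel, and the
marginals arise from P and Q through the map `evalAt z`. Data processing in both directions gives
equality (`klDiv_extend_eq`). What remains is finite-dimensional: integrate the logarithm of a ratio
of densities if B is positive definite, and refute absolute continuity if B is singular. -/

namespace SparseGP

/-! ### Lebesgue densities of nondegenerate Gaussians -/

section GaussianDensity

lemma map_withDensity_measurableEquiv {α β : Type*} [MeasurableSpace α] [MeasurableSpace β]
    (μ : Measure α) (f : α → ℝ≥0∞) (e : α ≃ᵐ β) :
    (μ.withDensity f).map e = (μ.map e).withDensity (f ∘ e.symm) := by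
  ext s hs
  rw [e.map_apply, withDensity_apply _ (e.measurable hs), withDensity_apply _ hs,
    e.restrict_map, lintegral_map_equiv]
  simp

variable {ι : Type*} [Fintype ι]

/-- Lebesgue measure is expressed through the Gaussian, not conversely, because the product formula
for integrals of independent functions needs a probability measure. The next lemma inverts the
density. -/
lemma volume_pi_eq_withDensity_pi_gaussianReal :
    (volume : Measure (ι → ℝ)) = (Measure.pi fun _ : ι => gaussianReal 0 1).withDensity
      (fun x => ∏ i, (gaussianPDF 0 1 (x i))⁻¹) := by
  have hvol : (gaussianReal 0 1).withDensity (fun x => (gaussianPDF 0 1 x)⁻¹) = volume := by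
    rw [gaussianReal_of_var_ne_zero 0 one_ne_zero]
    exact withDensity_inv_same (measurable_gaussianPDF 0 1)
      (.of_forall fun x => (gaussianPDF_pos 0 one_ne_zero x).ne')
      (.of_forall fun x => ENNReal.ofReal_ne_top)
  rw [volume_pi]
  refine Measure.pi_eq fun s hs => ?_
  have hmeas : ∀ i, Measurable ((s i).indicator fun x => (gaussianPDF 0 1 x)⁻¹) := fun i =>
    (measurable_gaussianPDF 0 1).inv.indicator (hs i)
  rw [withDensity_apply _ (.univ_pi hs), ← lintegral_indicator (.univ_pi hs)]
  have h (x : ι → ℝ) : (Set.univ.pi s).indicator (fun x => ∏ i, (gaussianPDF 0 1 (x i))⁻¹) x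
      = ∏ i, (s i).indicator (fun x => (gaussianPDF 0 1 x)⁻¹) (x i) := by
    by_cases hx : x ∈ Set.univ.pi s
    · rw [Set.indicator_of_mem hx]
      exact Finset.prod_congr rfl fun i _ =>
        (Set.indicator_of_mem (s := s i) (f := fun x => (gaussianPDF 0 1 x)⁻¹)
          (hx i (Set.mem_univ i))).symm
    · rw [Set.indicator_of_notMem hx]
      simp only [Set.mem_pi, Set.mem_univ, true_implies, not_forall] at hx
      obtain ⟨i, hi⟩ := hx
      exact (Finset.prod_eq_zero (Finset.mem_univ i) (Set.indicator_of_notMem hi _)).symm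
  simp_rw [h]
  rw [lintegral_prod_eq_prod_lintegral_of_indepFun Finset.univ
    (fun i (x : ι → ℝ) => (s i).indicator (fun x => (gaussianPDF 0 1 x)⁻¹) (x i))
    (iIndepFun_pi fun i => (hmeas i).aemeasurable)
    (fun i => (hmeas i).comp (measurable_pi_apply i))]
  refine Finset.prod_congr rfl fun i _ => ?_
  have := (measurePreserving_eval (fun _ : ι => gaussianReal 0 1) i).lintegral_comp (hmeas i)
  simp only [Function.eval] at this
  rw [this, lintegral_indicator (hs i), ← withDensity_apply _ (hs i), hvol]

lemma pi_gaussianReal_eq_withDensity_volume :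
    (Measure.pi fun _ : ι => gaussianReal 0 1) = (volume : Measure (ι → ℝ)).withDensity
      (fun x => ∏ i, gaussianPDF 0 1 (x i)) := by
  have h0 (x : ι → ℝ) (i : ι) : gaussianPDF 0 1 (x i) ≠ 0 :=
    (gaussianPDF_pos 0 one_ne_zero _).ne'
  have ht (x : ι → ℝ) (i : ι) : gaussianPDF 0 1 (x i) ≠ ∞ := ENNReal.ofReal_ne_top
  rw [volume_pi_eq_withDensity_pi_gaussianReal]
  have h : (fun x : ι → ℝ => ∏ i, gaussianPDF 0 1 (x i))
      = (fun x : ι → ℝ => ∏ i, (gaussianPDF 0 1 (x i))⁻¹)⁻¹ := by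
    funext x
    rw [Pi.inv_apply, ← ENNReal.prod_inv_distrib]
    · simp
    · intro i _ j _ _
      exact Or.inl (by simpa using h0 x i)
  rw [h]
  symm
  refine withDensity_inv_same ?_ (.of_forall fun x => ?_) (.of_forall fun x => ?_)
  · exact Finset.measurable_prod _ fun i _ =>
      ((measurable_gaussianPDF 0 1).comp (measurable_pi_apply i)).inv
  · exact Finset.prod_ne_zero_iff.2 fun i _ => by simpa using ht x i
  · exact ENNReal.prod_ne_top fun i _ => by simpa using h0 x i

/-- The Lebesgue density of the Gaussian `N(a, B)` for positive definite `B`. -/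
noncomputable def multivariateGaussianPDF [DecidableEq ι] (a : EuclideanSpace ℝ ι)
    (B : Matrix ι ι ℝ) (x : EuclideanSpace ℝ ι) : ℝ :=
  (√(2 * Real.pi))⁻¹ ^ Fintype.card ι * (√B.det)⁻¹
    * Real.exp (-(1 / 2) * ((x - a).ofLp ⬝ᵥ (B⁻¹ *ᵥ (x - a).ofLp)))

lemma stdGaussian_eq_withDensity_volume [DecidableEq ι] :
    stdGaussian (EuclideanSpace ℝ ι)
      = volume.withDensity (fun x => ENNReal.ofReal (multivariateGaussianPDF 0 1 x)) := by
  rw [← map_pi_eq_stdGaussian, pi_gaussianReal_eq_withDensity_volume]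
  have := map_withDensity_measurableEquiv (volume : Measure (ι → ℝ))
    (fun x => ∏ i, gaussianPDF 0 1 (x i)) (MeasurableEquiv.toLp 2 (ι → ℝ))
  rw [MeasurableEquiv.coe_toLp, (PiLp.volume_preserving_toLp ι).map_eq] at this
  rw [this]
  congr 1
  funext x
  simp only [Function.comp_apply, gaussianPDF]
  rw [← ENNReal.ofReal_prod_of_nonneg fun i _ => gaussianPDFReal_nonneg _ _ _]
  congr 1
  simp only [gaussianPDFReal, multivariateGaussianPDF]
  rw [Finset.prod_mul_distrib, ← Real.exp_sum]
  simp [dotProduct, Finset.mul_sum, sq, div_eq_inv_mul]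

open scoped MatrixOrder in
-- Change of variables: N(a, B) is the image of the standard Gaussian under the affine bijection x ↦
-- a + √B x, whose Jacobian is √(det B).
lemma multivariateGaussian_eq_withDensity_volume [DecidableEq ι] (a : EuclideanSpace ℝ ι)
    {B : Matrix ι ι ℝ} (hB : B.PosDef) :
    multivariateGaussian a B
      = volume.withDensity (fun x => ENNReal.ofReal (multivariateGaussianPDF a B x)) := by
  set S := CFC.sqrt B with hS
  have hSS : S * S = B := CFC.sqrt_mul_sqrt_self _ hB.posSemidef.nonneg
  have hSdet : S.det = √B.det := by
    rw [hS, hB.posSemidef.det_sqrt, RCLike.sqrt_of_nonneg hB.det_pos.le]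
    simp
  have hdet : 0 < S.det := hSdet ▸ Real.sqrt_pos.2 hB.det_pos
  have hunit : IsUnit S.det := hdet.ne'.isUnit
  have hST : Sᵀ = S := by
    have : Sᴴ = S := (CFC.sqrt_nonneg B).isSelfAdjoint
    simpa using this
  let e : EuclideanSpace ℝ ι ≃ᵐ EuclideanSpace ℝ ι :=
    { toFun := fun x => a + toEuclideanCLM (𝕜 := ℝ) S x
      invFun := fun x => toEuclideanCLM (𝕜 := ℝ) S⁻¹ (x - a)
      left_inv := fun x => by
        ext1
        simp [mulVec_mulVec, nonsing_inv_mul _ hunit]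
      right_inv := fun x => by
        ext1
        simp [mulVec_mulVec, mul_nonsing_inv _ hunit]
      measurable_toFun := by
        change Measurable fun x => a + toEuclideanCLM (𝕜 := ℝ) S x
        fun_prop
      measurable_invFun := by
        change Measurable fun x => toEuclideanCLM (𝕜 := ℝ) S⁻¹ (x - a)
        fun_prop }
  have hvol : (volume : Measure (EuclideanSpace ℝ ι)).map e
      = ENNReal.ofReal (√B.det)⁻¹ • volume := by
    have h1 : (e : EuclideanSpace ℝ ι → EuclideanSpace ℝ ι)
        = (fun x => a + x) ∘ (toEuclideanLin S) := rfl
    have h2 : LinearMap.det (toEuclideanLin S) = S.det :=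
      (congrArg LinearMap.det (DFunLike.congr_fun (toLpLin_eq_toLin 2 2) S)).trans
        (LinearMap.det_toLin _ S)
    have h3 : Measurable (toEuclideanLin S) := (toEuclideanCLM (𝕜 := ℝ) S).continuous.measurable
    rw [h1, ← Measure.map_map (measurable_const_add a) h3,
      Measure.map_linearMap_addHaar_eq_smul_addHaar _ (h2 ▸ hdet.ne'), Measure.map_smul,
      map_add_left_eq_self, h2, abs_of_pos (inv_pos.2 hdet), hSdet]
  have h : multivariateGaussian a B = (stdGaussian (EuclideanSpace ℝ ι)).map e := rfl
  rw [h, stdGaussian_eq_withDensity_volume, map_withDensity_measurableEquiv, hvol,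
    withDensity_smul_measure, ← withDensity_smul' _ _ ENNReal.ofReal_ne_top]
  congr 1
  funext x
  simp only [Pi.smul_apply, Function.comp_apply, smul_eq_mul]
  rw [← ENNReal.ofReal_mul (by positivity)]
  congr 1
  have he : (e.symm x).ofLp = S⁻¹ *ᵥ (x - a).ofLp := rfl
  -- With S = √B symmetric, |S⁻¹(x - a)|² = (x - a)ᵀ(SS)⁻¹(x - a).
  have hq : (e.symm x).ofLp ⬝ᵥ (e.symm x).ofLp = (x - a).ofLp ⬝ᵥ (B⁻¹ *ᵥ (x - a).ofLp) := by
    rw [he, dotProduct_mulVec, vecMul_mulVec, ← dotProduct_mulVec, transpose_nonsing_inv, hST,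
      ← hSS, Matrix.mul_inv_rev]
  simp only [multivariateGaussianPDF, sub_zero, inv_one, one_mulVec, det_one, Real.sqrt_one,
    mul_one]
  rw [hq]
  ring

lemma multivariateGaussianPDF_pos [DecidableEq ι] (a : EuclideanSpace ℝ ι)
    {B : Matrix ι ι ℝ} (hB : B.PosDef) (x : EuclideanSpace ℝ ι) :
    0 < multivariateGaussianPDF a B x := by
  have := hB.det_pos
  unfold multivariateGaussianPDF
  positivity

lemma measurable_multivariateGaussianPDF [DecidableEq ι] (a : EuclideanSpace ℝ ι)
    (B : Matrix ι ι ℝ) : Measurable (multivariateGaussianPDF a B) := by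
  unfold multivariateGaussianPDF dotProduct mulVec dotProduct
  fun_prop

lemma volume_absolutelyContinuous_multivariateGaussian [DecidableEq ι] (a : EuclideanSpace ℝ ι)
    {B : Matrix ι ι ℝ} (hB : B.PosDef) : volume ≪ multivariateGaussian a B := by
  rw [multivariateGaussian_eq_withDensity_volume a hB]
  exact withDensity_absolutelyContinuous'
    (measurable_multivariateGaussianPDF a B).ennreal_ofReal.aemeasurable
    (.of_forall fun x => by simpa using multivariateGaussianPDF_pos a hB x)

lemma isOpenPosMeasure_multivariateGaussian [DecidableEq ι] (a : EuclideanSpace ℝ ι)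
    {B : Matrix ι ι ℝ} (hB : B.PosDef) : (multivariateGaussian a B).IsOpenPosMeasure :=
  (volume_absolutelyContinuous_multivariateGaussian a hB).isOpenPosMeasure

lemma multivariateGaussian_absolutelyContinuous [DecidableEq ι] (a m : EuclideanSpace ℝ ι)
    {B K : Matrix ι ι ℝ} (hB : B.PosDef) (hK : K.PosDef) :
    multivariateGaussian a B ≪ multivariateGaussian m K := by
  refine Measure.AbsolutelyContinuous.trans ?_
    (volume_absolutelyContinuous_multivariateGaussian m hK)
  rw [multivariateGaussian_eq_withDensity_volume a hB]
  exact withDensity_absolutelyContinuous _ _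

end GaussianDensity

/-! ### Divergence between finite-dimensional Gaussians -/

section GaussianKL

variable {ι : Type*} [Fintype ι] [DecidableEq ι]

lemma memLp_eval_multivariateGaussian (a : EuclideanSpace ℝ ι) (B : Matrix ι ι ℝ) (i : ι) :
    MemLp (fun x : EuclideanSpace ℝ ι => x i) 2 (multivariateGaussian a B) :=
  IsGaussian.memLp_dual (multivariateGaussian a B) (EuclideanSpace.proj i) 2 (by simp)

lemma integral_eval_multivariateGaussian (a : EuclideanSpace ℝ ι) (B : Matrix ι ι ℝ) (i : ι) :
    ∫ x, x i ∂(multivariateGaussian a B) = a i := by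
  have := ContinuousLinearMap.integral_comp_comm (EuclideanSpace.proj (𝕜 := ℝ) i)
    (IsGaussian.integrable_id (μ := multivariateGaussian a B))
  simpa using this

lemma integrable_quadratic_multivariateGaussian (a m : EuclideanSpace ℝ ι)
    (A B : Matrix ι ι ℝ) :
    Integrable (fun x => (x - m).ofLp ⬝ᵥ (A *ᵥ (x - m).ofLp)) (multivariateGaussian a B) := by
  have h (i : ι) := (memLp_eval_multivariateGaussian a B i).sub (memLp_const (m i))
  simp only [dotProduct, mulVec, Finset.mul_sum]
  refine integrable_finsetSum _ fun i _ => integrable_finsetSum _ fun j _ => ?_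
  refine (((h i).integrable_mul (h j)).const_mul (A i j)).congr (.of_forall fun x => ?_)
  simp only [Pi.mul_apply, Pi.sub_apply, PiLp.sub_apply]
  ring

/-- Expand into the second moments about m, which are B i j + (a i - m i)(a j - m j). Symmetry of B
turns the sum of A i j * B i j into a trace. -/
lemma integral_quadratic_multivariateGaussian (a m : EuclideanSpace ℝ ι)
    (A : Matrix ι ι ℝ) {B : Matrix ι ι ℝ} (hB : B.PosSemidef) :
    ∫ x, (x - m).ofLp ⬝ᵥ (A *ᵥ (x - m).ofLp) ∂(multivariateGaussian a B)
      = (B * A).trace + (a - m).ofLp ⬝ᵥ (A *ᵥ (a - m).ofLp) := by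
  set μ := multivariateGaussian a B
  have h (i : ι) : MemLp (fun x : EuclideanSpace ℝ ι => x i - m i) 2 μ :=
    (memLp_eval_multivariateGaussian a B i).sub (memLp_const (m i))
  have hint (i j : ι) : Integrable (fun x : EuclideanSpace ℝ ι => (x i - m i) * (x j - m j)) μ :=
    (h i).integrable_mul (h j)
  have hi (i : ι) : Integrable (fun x : EuclideanSpace ℝ ι => x i) μ :=
    (memLp_eval_multivariateGaussian a B i).integrable (by norm_num)
  have hmean (i : ι) : ∫ x, (x i - m i) ∂μ = a i - m i := by
    rw [integral_sub (hi i) (integrable_const _), integral_eval_multivariateGaussian]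
    simp
  have hE (i j : ι) : ∫ x, (x i - m i) * (x j - m j) ∂μ
      = B i j + (a i - m i) * (a j - m j) := by
    have h1 := covariance_eq_sub (h i) (h j)
    rw [covariance_sub_const_left (hi i), covariance_sub_const_right (hi j),
      covariance_eval_multivariateGaussian hB, hmean, hmean] at h1
    simp only [Pi.mul_apply] at h1
    linarith
  have hBt (i j : ι) : B j i = B i j := by
    have := hB.isHermitian.apply i j
    simpa using this
  have hexp (x : EuclideanSpace ℝ ι) : (x - m).ofLp ⬝ᵥ (A *ᵥ (x - m).ofLp)
      = ∑ i, ∑ j, A i j * ((x i - m i) * (x j - m j)) := by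
    simp only [dotProduct, mulVec, Finset.mul_sum, PiLp.sub_apply]
    exact Finset.sum_congr rfl fun i _ => Finset.sum_congr rfl fun j _ => by ring
  have h1 (i j : ι) : Integrable (fun x : EuclideanSpace ℝ ι =>
      A i j * ((x i - m i) * (x j - m j))) μ := (hint i j).const_mul _
  have h2 (i : ι) : Integrable (fun x : EuclideanSpace ℝ ι =>
      ∑ j, A i j * ((x i - m i) * (x j - m j))) μ := integrable_finsetSum _ fun j _ => h1 i j
  have h3 (i : ι) : ∫ x, ∑ j, A i j * ((x i - m i) * (x j - m j)) ∂μ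
      = ∑ j, A i j * B i j + ∑ j, A i j * ((a i - m i) * (a j - m j)) := by
    rw [integral_finsetSum _ fun j _ => h1 i j, ← Finset.sum_add_distrib]
    exact Finset.sum_congr rfl fun j _ => by rw [integral_const_mul, hE, mul_add]
  rw [integral_congr_ae (.of_forall hexp), integral_finsetSum _ fun i _ => h2 i,
    Finset.sum_congr rfl fun i _ => h3 i, Finset.sum_add_distrib, hexp a]
  congr 1
  rw [Finset.sum_comm]
  simp only [trace, diag, mul_apply]
  exact Finset.sum_congr rfl fun i _ => Finset.sum_congr rfl fun j _ => by
    rw [hBt, mul_comm]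

lemma llr_multivariateGaussian (a m : EuclideanSpace ℝ ι) {B K : Matrix ι ι ℝ}
    (hB : B.PosDef) (hK : K.PosDef) :
    llr (multivariateGaussian a B) (multivariateGaussian m K) =ᵐ[multivariateGaussian a B]
      fun x => Real.log (multivariateGaussianPDF a B x / multivariateGaussianPDF m K x) := by
  have hac := multivariateGaussian_absolutelyContinuous a m hB hK
  have hgm := (measurable_multivariateGaussianPDF m K).ennreal_ofReal
  have hd : Measurable (fun x => ENNReal.ofReal
      (multivariateGaussianPDF a B x / multivariateGaussianPDF m K x)) :=
    ((measurable_multivariateGaussianPDF a B).div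
      (measurable_multivariateGaussianPDF m K)).ennreal_ofReal
  have h : multivariateGaussian a B = (multivariateGaussian m K).withDensity
      (fun x => ENNReal.ofReal
        (multivariateGaussianPDF a B x / multivariateGaussianPDF m K x)) := by
    rw [multivariateGaussian_eq_withDensity_volume m hK,
      ← withDensity_mul _ hgm hd,
      multivariateGaussian_eq_withDensity_volume a hB]
    congr 1
    funext x
    have := multivariateGaussianPDF_pos m hK x
    rw [Pi.mul_apply, ← ENNReal.ofReal_mul this.le, mul_div_cancel₀ _ this.ne']
  have h1 := Measure.rnDeriv_withDensity (multivariateGaussian m K) hd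
  rw [← h] at h1
  filter_upwards [hac.ae_le h1] with x hx
  rw [llr, hx, ENNReal.toReal_ofReal (div_pos (multivariateGaussianPDF_pos a hB x)
    (multivariateGaussianPDF_pos m hK x)).le]

lemma log_multivariateGaussianPDF (a : EuclideanSpace ℝ ι) {B : Matrix ι ι ℝ}
    (hB : B.PosDef) (x : EuclideanSpace ℝ ι) :
    Real.log (multivariateGaussianPDF a B x)
      = Real.log ((√(2 * Real.pi))⁻¹ ^ Fintype.card ι) - 1 / 2 * Real.log B.det
        - 1 / 2 * ((x - a).ofLp ⬝ᵥ (B⁻¹ *ᵥ (x - a).ofLp)) := by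
  have hdet := Real.sqrt_pos.2 hB.det_pos
  have hpi : 0 < √(2 * Real.pi) := by positivity
  rw [multivariateGaussianPDF, Real.log_mul (by positivity) (by positivity),
    Real.log_mul (by positivity) (by positivity), Real.log_exp, Real.log_inv,
    Real.log_sqrt hB.det_pos.le]
  ring

/-- The log-likelihood ratio is a constant plus two quadratic forms, both integrable. The form in
B⁻¹, centred at a, has expectation tr(BB⁻¹) and yields the term -M/2; the form in K⁻¹ yields the
other trace and the mean term. -/
theorem klDiv_multivariateGaussian (a m : EuclideanSpace ℝ ι) {B K : Matrix ι ι ℝ}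
    (hB : B.PosDef) (hK : K.PosDef) :
    InformationTheory.klDiv (multivariateGaussian a B) (multivariateGaussian m K) ≠ ∞ ∧
    (InformationTheory.klDiv (multivariateGaussian a B) (multivariateGaussian m K)).toReal
      = -(1 / 2) * Real.log (B * K⁻¹).det + (1 / 2) * (B * K⁻¹).trace
        - (Fintype.card ι : ℝ) / 2
        + (1 / 2) * ((a - m).ofLp ⬝ᵥ (K⁻¹ *ᵥ (a - m).ofLp)) := by
  have hac := multivariateGaussian_absolutelyContinuous a m hB hK
  have hBd := hB.det_pos
  have hKd := hK.det_pos
  have hllr : llr (multivariateGaussian a B) (multivariateGaussian m K)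
      =ᵐ[multivariateGaussian a B] fun x =>
        (-(1 / 2) * Real.log (B * K⁻¹).det
          - 1 / 2 * ((x - a).ofLp ⬝ᵥ (B⁻¹ *ᵥ (x - a).ofLp)))
          + 1 / 2 * ((x - m).ofLp ⬝ᵥ (K⁻¹ *ᵥ (x - m).ofLp)) := by
    filter_upwards [llr_multivariateGaussian a m hB hK] with x hx
    rw [hx, Real.log_div (multivariateGaussianPDF_pos a hB x).ne'
      (multivariateGaussianPDF_pos m hK x).ne', log_multivariateGaussianPDF a hB,
      log_multivariateGaussianPDF m hK, det_mul, det_nonsing_inv, Ring.inverse_eq_inv',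
      Real.log_mul hBd.ne' (inv_ne_zero hKd.ne'), Real.log_inv]
    ring
  have hq1 := (integrable_quadratic_multivariateGaussian a a B⁻¹ B).const_mul (1 / 2)
  have hq2 := (integrable_quadratic_multivariateGaussian a m K⁻¹ B).const_mul (1 / 2)
  have hc : Integrable (fun _ : EuclideanSpace ℝ ι => -(1 / 2) * Real.log (B * K⁻¹).det)
    (multivariateGaussian a B) := integrable_const _
  have hcq : Integrable (fun x : EuclideanSpace ℝ ι => -(1 / 2) * Real.log (B * K⁻¹).det
      - 1 / 2 * ((x - a).ofLp ⬝ᵥ (B⁻¹ *ᵥ (x - a).ofLp))) (multivariateGaussian a B) := hc.sub hq1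
  have hint := (integrable_congr hllr).2 (hcq.add hq2)
  refine ⟨InformationTheory.klDiv_ne_top hac hint, ?_⟩
  rw [InformationTheory.toReal_klDiv_of_measure_eq hac (by simp), integral_congr_ae hllr,
    integral_add hcq hq2, integral_sub hc hq1, integral_const, integral_const_mul,
    integral_const_mul,
    integral_quadratic_multivariateGaussian a a _ hB.posSemidef,
    integral_quadratic_multivariateGaussian a m _ hB.posSemidef,
    mul_nonsing_inv _ hBd.ne'.isUnit, trace_one]
  simp
  ring

/-- Along a direction v with vᵀBv = 0 the first Gaussian projects to a point mass, whereas the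
second projects to a Gaussian of positive variance, which has no atoms. -/
lemma not_absolutelyContinuous_of_not_posDef (a m : EuclideanSpace ℝ ι) {B K : Matrix ι ι ℝ}
    (hB : B.PosSemidef) (hB' : ¬ B.PosDef) (hK : K.PosDef) :
    ¬ multivariateGaussian a B ≪ multivariateGaussian m K := by
  intro hac
  obtain ⟨v, hv0, hv⟩ : ∃ v : ι → ℝ, v ≠ 0 ∧ v ⬝ᵥ (B *ᵥ v) = 0 := by
    by_contra! h
    exact hB' (.of_dotProduct_mulVec_pos hB.1 fun v hv =>
      lt_of_le_of_ne (hB.dotProduct_mulVec_nonneg v) (by simpa using (h v hv).symm))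
  let L : StrongDual ℝ (EuclideanSpace ℝ ι) := innerSL ℝ (WithLp.toLp 2 v)
  have hvar (b : EuclideanSpace ℝ ι) {C : Matrix ι ι ℝ} (hC : C.PosSemidef) :
      Var[L; multivariateGaussian b C] = v ⬝ᵥ (C *ᵥ v) := by
    have h1 := covarianceBilin_multivariateGaussian (μ := b) hC (WithLp.toLp 2 v)
      (WithLp.toLp 2 v)
    rw [covarianceBilin_self IsGaussian.memLp_two_id] at h1
    exact h1
  have hmapB := IsGaussian.map_eq_gaussianReal (μ := multivariateGaussian a B) L
  have hmapK := IsGaussian.map_eq_gaussianReal (μ := multivariateGaussian m K) L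
  rw [hvar a hB, hv, Real.toNNReal_zero, gaussianReal_zero_var] at hmapB
  rw [hvar m hK.posSemidef] at hmapK
  have hpos : 0 < v ⬝ᵥ (K *ᵥ v) := by simpa using hK.dotProduct_mulVec_pos hv0
  have := nullSingletonClass_gaussianReal (μ := (multivariateGaussian m K)[L])
    (Real.toNNReal_pos.2 hpos).ne'
  have h := hac.map L.continuous.measurable
  rw [hmapB, hmapK] at h
  have h0 := h (measure_singleton ((multivariateGaussian a B)[L]))
  simp at h0

end GaussianKL

variable {X : Type*}

lemma measurable_evalAt {M : ℕ} (z : Fin M → X) : Measurable (evalAt z) := by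
  unfold evalAt
  exact (MeasurableEquiv.toLp 2 (Fin M → ℝ)).measurable.comp (by fun_prop)

/-! ### Uniqueness of the continuous conditional distribution -/

section Uniqueness

/-- Two finite measures on a function space agree if they integrate bounded continuous functions
of finitely many values in the same way. -/
lemma measure_ext_of_integral_evalAt {μ ν : Measure (X → ℝ)} [IsFiniteMeasure μ]
    [IsFiniteMeasure ν]
    (h : ∀ (n : ℕ) (x : Fin n → X) (φ : EuclideanSpace ℝ (Fin n) →ᵇ ℝ),
      ∫ f, φ (evalAt x f) ∂μ = ∫ f, φ (evalAt x f) ∂ν) : μ = ν := by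
  refine IsProjectiveLimit.unique (P := fun I : Finset X => μ.map I.restrict)
    (fun I => rfl) (fun I => ?_)
  symm
  refine ext_of_forall_integral_eq_of_IsFiniteMeasure fun φ => ?_
  have hI : Measurable (I.restrict : (X → ℝ) → I → ℝ) := by fun_prop
  rw [integral_map hI.aemeasurable (by fun_prop), integral_map hI.aemeasurable (by fun_prop)]
  -- Reindexing by an enumeration of I turns a test function on I → ℝ into one of the form admitted
  -- by the hypothesis.
  let g : C(EuclideanSpace ℝ (Fin I.card), I → ℝ) :=
    ⟨fun y i => y (I.equivFin i), by fun_prop⟩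
  have hg (f : X → ℝ) : I.restrict f = g (evalAt (fun k => (I.equivFin.symm k : X)) f) := by
    ext i
    simp [g, evalAt]
  have := h I.card (fun k => (I.equivFin.symm k : X)) (φ.compContinuous g)
  simp only [BoundedContinuousFunction.compContinuous_apply] at this
  simpa only [hg] using this

lemma IsConditional.unique {P : Measure (X → ℝ)} [IsProbabilityMeasure P] {M : ℕ}
    {z : Fin M → X} [(P.map (evalAt z)).IsOpenPosMeasure]
    {κ η : Kernel (EuclideanSpace ℝ (Fin M)) (X → ℝ)}
    (hκ : IsConditional P z κ) (hη : IsConditional P z η) : κ = η := by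
  have := hκ.markov
  have := hη.markov
  have hP : IsProbabilityMeasure (P.map (evalAt z)) :=
    Measure.isProbabilityMeasure_map (measurable_evalAt z).aemeasurable
  ext1 y
  refine measure_ext_of_integral_evalAt fun n x φ => ?_
  suffices h : (fun y => ∫ f, φ (evalAt x f) ∂(κ y)) = fun y => ∫ f, φ (evalAt x f) ∂(η y) from
    congrFun h y
  -- Both sides are continuous in y and the law of f_M has full support, so almost everywhere
  -- equality suffices. It follows by integrating over sets s × univ under the common joint law.
  rw [← (hκ.continuous n x φ).ae_eq_iff_eq (P.map (evalAt z)) (hη.continuous n x φ)]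
  have hφ : Measurable fun f : X → ℝ => φ (evalAt x f) :=
    φ.continuous.measurable.comp (measurable_evalAt x)
  have hint (ρ : Measure (EuclideanSpace ℝ (Fin M) × (X → ℝ))) [IsFiniteMeasure ρ] :
      Integrable (fun p => φ (evalAt x p.2)) ρ :=
    .of_bound (hφ.comp measurable_snd).aestronglyMeasurable ‖φ‖
      (.of_forall fun p => φ.norm_coe_le_norm _)
  refine Integrable.ae_eq_of_forall_setIntegral_eq _ _
    (hint ((P.map (evalAt z)) ⊗ₘ κ)).integral_compProd
    (hint ((P.map (evalAt z)) ⊗ₘ η)).integral_compProd fun s hs _ => ?_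
  have h1 := Measure.setIntegral_compProd (μ := P.map (evalAt z)) (κ := κ) hs .univ
    (hint _).integrableOn
  have h2 := Measure.setIntegral_compProd (μ := P.map (evalAt z)) (κ := η) hs .univ
    (hint _).integrableOn
  simp only [Measure.restrict_univ] at h1 h2
  rw [← h1, ← h2, hκ.disintegrate, hη.disintegrate]

end Uniqueness

/-! ### Data processing in both directions -/

section KLDiv

/-- Extending two laws of `f_M` by the same conditional does not change their divergence. -/
lemma klDiv_extend_eq {P : Measure (X → ℝ)} [IsProbabilityMeasure P] {M : ℕ} {z : Fin M → X}
    {κ : Kernel (EuclideanSpace ℝ (Fin M)) (X → ℝ)} (hκ : IsConditional P z κ)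
    (a : EuclideanSpace ℝ (Fin M)) (B : Matrix (Fin M) (Fin M) ℝ)
    (hmap : (extend κ a B).map (evalAt z) = multivariateGaussian a B) :
    InformationTheory.klDiv (extend κ a B) P
      = InformationTheory.klDiv ((extend κ a B).map (evalAt z)) (P.map (evalAt z)) := by
  have := hκ.markov
  have hP : IsProbabilityMeasure (P.map (evalAt z)) :=
    Measure.isProbabilityMeasure_map (measurable_evalAt z).aemeasurable
  -- P is itself the extension of its own marginal, so the same kernel produces both P and Q.
  have hbind : (P.map (evalAt z)).bind κ = P := by
    rw [← Measure.snd_compProd, hκ.disintegrate, Measure.snd,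
      Measure.map_map measurable_snd ((measurable_evalAt z).prodMk measurable_id')]
    exact Measure.map_id
  have : IsProbabilityMeasure (extend κ a B) := by
    unfold extend
    infer_instance
  refine le_antisymm ?_ (InformationTheory.klDiv_map_le _ _ (measurable_evalAt z))
  rw [hmap]
  calc InformationTheory.klDiv (extend κ a B) P
      = InformationTheory.klDiv ((multivariateGaussian a B).bind κ)
          ((P.map (evalAt z)).bind κ) := by rw [hbind]; rfl
    _ ≤ _ := InformationTheory.klDiv_comp_right_le _ _ κ

end KLDiv

variable {M : ℕ}

/-! ### Regression on the inducing values -/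

section Regression

/-- The regression weights `k_M(x) K_MM⁻¹` of `f x` on `f_M`. -/
noncomputable def weights (K : X → X → ℝ) (z : Fin M → X) (x : X) : Fin M → ℝ :=
  kvec K z x ᵥ* (gram K z)⁻¹

/-- The residual process of the regression on `f_M`. -/
noncomputable def residual (K : X → X → ℝ) (z : Fin M → X) (f : X → ℝ) : X → ℝ :=
  fun x => f x - weights K z x ⬝ᵥ (evalAt z f).ofLp

/-- The function with regression part determined by the first component and residual given by the
second one. -/
noncomputable def recombine (K : X → X → ℝ) (z : Fin M → X)
    (p : EuclideanSpace ℝ (Fin M) × (X → ℝ)) : X → ℝ :=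
  fun x => p.2 x + weights K z x ⬝ᵥ p.1.ofLp

variable (K : X → X → ℝ) (z : Fin M → X)

lemma measurable_residual : Measurable (residual K z) := by
  unfold residual dotProduct evalAt
  fun_prop

lemma measurable_recombine : Measurable (recombine K z) := by
  unfold recombine dotProduct
  fun_prop

lemma recombine_evalAt_residual (f : X → ℝ) : recombine K z (evalAt z f, residual K z f) = f := by
  funext x
  simp [recombine, residual]

lemma measurable_recombine_mk (y : EuclideanSpace ℝ (Fin M)) :
    Measurable fun r => recombine K z (y, r) :=
  (measurable_recombine K z).comp measurable_prodMk_left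

lemma measurable_recombine_residual :
    Measurable fun p : EuclideanSpace ℝ (Fin M) × (X → ℝ) =>
      recombine K z (p.1, residual K z p.2) :=
  (measurable_recombine K z).comp (measurable_id.prodMap (measurable_residual K z))

variable {K z}

/-- Hence the residual vanishes at the inducing points, and a recombined function takes the
prescribed values y there. -/
lemma weights_apply_inducing (hK : (gram K z).PosDef) (j : Fin M) :
    weights K z (z j) = Pi.single j 1 := by
  have h : weights K z (z j) = (gram K z * (gram K z)⁻¹) j := rfl
  rw [h, mul_nonsing_inv _ hK.det_pos.ne'.isUnit]
  ext i
  simp [one_apply, Pi.single_apply, eq_comm]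

lemma weights_vecMul_gram (hK : (gram K z).PosDef) (x : X) :
    weights K z x ᵥ* gram K z = kvec K z x := by
  rw [weights, vecMul_vecMul, nonsing_inv_mul _ hK.det_pos.ne'.isUnit, vecMul_one]

lemma evalAt_recombine_residual (hK : (gram K z).PosDef) (y : EuclideanSpace ℝ (Fin M))
    (f : X → ℝ) : evalAt z (recombine K z (y, residual K z f)) = y := by
  ext i
  simp [evalAt, recombine, residual, weights_apply_inducing hK]

end Regression

/-! ### Independence of the residual and f_M -/

section Independence

variable {m : X → ℝ} {K : X → X → ℝ} {P : Measure (X → ℝ)} {z : Fin M → X}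

lemma IsGPLaw.memLp_two (hP : IsGPLaw m K P) (x : X) : MemLp (fun f : X → ℝ => f x) 2 P :=
  (hP.gaussian.hasGaussianLaw_eval x).memLp_two

lemma IsGPLaw.symm (hP : IsGPLaw m K P) (x x' : X) : K x x' = K x' x := by
  rw [← hP.cov, ← hP.cov, covariance_comm]

lemma IsGPLaw.memLp_two_dotProduct (hP : IsGPLaw m K P) (w : Fin M → ℝ) :
    MemLp (fun f : X → ℝ => w ⬝ᵥ (evalAt z f).ofLp) 2 P :=
  memLp_finsetSum _ fun i _ => (hP.memLp_two (z i)).const_mul (w i)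

lemma IsGPLaw.covariance_dotProduct (hP : IsGPLaw m K P) (x : X) (w : Fin M → ℝ) :
    covariance (fun f : X → ℝ => f x) (fun f => w ⬝ᵥ (evalAt z f).ofLp) P
      = w ⬝ᵥ kvec K z x := by
  have := hP.gaussian.isProbabilityMeasure
  simp only [dotProduct, evalAt]
  rw [covariance_fun_sum_right (fun i => (hP.memLp_two (z i)).const_mul (w i)) (hP.memLp_two x)]
  simp [covariance_const_mul_right, hP.cov, kvec]

lemma IsGPLaw.covariance_eval_residual (hP : IsGPLaw m K P) (x x' : X) :
    covariance (fun f : X → ℝ => f x) (fun f => residual K z f x') P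
      = K x x' - weights K z x' ⬝ᵥ kvec K z x := by
  have := hP.gaussian.isProbabilityMeasure
  simp only [residual]
  rw [covariance_fun_sub_right (hP.memLp_two x) (hP.memLp_two x') (hP.memLp_two_dotProduct _),
    hP.cov, hP.covariance_dotProduct]

lemma IsGPLaw.memLp_two_residual (hP : IsGPLaw m K P) (x : X) :
    MemLp (fun f => residual K z f x) 2 P :=
  (hP.memLp_two x).sub (hP.memLp_two_dotProduct _)

/-- These are the normal equations w(x) K_MM = k_M(x), read in coordinate i. -/
lemma IsGPLaw.covariance_inducing_residual (hP : IsGPLaw m K P) (hK : (gram K z).PosDef)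
    (i : Fin M) (x : X) :
    covariance (fun f : X → ℝ => f (z i)) (fun f => residual K z f x) P = 0 := by
  have h : weights K z x ⬝ᵥ kvec K z (z i) = K x (z i) := by
    have h1 := congrFun (weights_vecMul_gram hK x) i
    have h2 : kvec K z (z i) = fun j => gram K z j i := funext fun j => hP.symm _ _
    rw [h2]
    exact h1
  rw [hP.covariance_eval_residual, h, hP.symm, sub_self]

lemma IsGPLaw.covariance_residual (hP : IsGPLaw m K P) (hK : (gram K z).PosDef) (x x' : X) :
    covariance (fun f => residual K z f x) (fun f => residual K z f x') P
      = K x x' - weights K z x' ⬝ᵥ kvec K z x := by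
  have := hP.gaussian.isProbabilityMeasure
  have h0 : covariance (fun f => weights K z x ⬝ᵥ (evalAt z f).ofLp)
      (fun f => residual K z f x') P = 0 := by
    simp only [dotProduct, evalAt]
    rw [covariance_fun_sum_left (fun i => (hP.memLp_two (z i)).const_mul _)
      (hP.memLp_two_residual x')]
    simp [covariance_const_mul_left, hP.covariance_inducing_residual hK]
  have h1 := covariance_fun_sub_left (hP.memLp_two x)
    (hP.memLp_two_dotProduct (z := z) (weights K z x)) (hP.memLp_two_residual (z := z) x')
  rw [h0, hP.covariance_eval_residual, sub_zero] at h1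
  exact h1

/-- Each member of the family is a linear combination of finitely many values of f. Joint
Gaussianity is what lets zero covariance imply independence. -/
lemma IsGPLaw.isGaussianProcess_sumElim (hP : IsGPLaw m K P) :
    IsGaussianProcess (Sum.elim (fun (i : Fin M) (f : X → ℝ) => f (z i))
      (fun (x : X) (f : X → ℝ) => residual K z f x)) P := by
  classical
  refine hP.gaussian.of_isGaussianProcess fun s => ?_
  rcases s with i | x
  · exact ⟨{z i}, ContinuousLinearMap.proj ⟨z i, by simp⟩, fun f => rfl⟩
  · refine ⟨insert x (Finset.univ.image z), ContinuousLinearMap.proj ⟨x, by simp⟩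
      - ∑ i, weights K z x i • ContinuousLinearMap.proj ⟨z i, by simp⟩, fun f => ?_⟩
    simp [residual, dotProduct, evalAt]

lemma IsGPLaw.indepFun_evalAt_residual (hP : IsGPLaw m K P) (hK : (gram K z).PosDef) :
    IndepFun (evalAt z) (residual K z) P := by
  have h := hP.isGaussianProcess_sumElim (z := z).indepFun_of_covariance_eq_zero
    (fun i => (hP.memLp_two (z i)).aemeasurable)
    (fun x => (hP.memLp_two_residual x).aemeasurable)
    (hP.covariance_inducing_residual hK)
  exact h.comp (MeasurableEquiv.toLp 2 (Fin M → ℝ)).measurable measurable_id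

lemma IsGPLaw.map_evalAt_residual (hP : IsGPLaw m K P) (hK : (gram K z).PosDef) :
    P.map (fun f => (evalAt z f, residual K z f))
      = (P.map (evalAt z)).prod (P.map (residual K z)) := by
  have := hP.gaussian.isProbabilityMeasure
  exact (indepFun_iff_map_prod_eq_prod_map_map (measurable_evalAt z).aemeasurable
    (measurable_residual K z).aemeasurable).1 (hP.indepFun_evalAt_residual hK)

end Independence

/-! ### Existence of the continuous conditional distribution -/

section Conditional

/-- Matheron's form of the conditional distribution: the regression on `f_M` is replaced by the
regression on `y`, and the residual keeps its law. -/
noncomputable def conditional (K : X → X → ℝ) (P : Measure (X → ℝ)) (z : Fin M → X) :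
    Kernel (EuclideanSpace ℝ (Fin M)) (X → ℝ) :=
  (Kernel.id ×ₖ Kernel.const _ (P.map (residual K z))).map (recombine K z)

variable {m : X → ℝ} {K : X → X → ℝ} {P : Measure (X → ℝ)} {z : Fin M → X}

lemma conditional_apply [IsProbabilityMeasure P] (y : EuclideanSpace ℝ (Fin M)) :
    conditional K P z y = (P.map (residual K z)).map (fun r => recombine K z (y, r)) := by
  rw [conditional, Kernel.map_apply _ (measurable_recombine K z), Kernel.prod_apply,
    Kernel.id_apply, Kernel.const_apply, Measure.dirac_prod,
    Measure.map_map (measurable_recombine K z) measurable_prodMk_left]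
  rfl

lemma isMarkovKernel_conditional [IsProbabilityMeasure P] :
    IsMarkovKernel (conditional K P z) := by
  have : IsProbabilityMeasure (P.map (residual K z)) :=
    Measure.isProbabilityMeasure_map (measurable_residual K z).aemeasurable
  exact Kernel.IsMarkovKernel.map _ (measurable_recombine K z)

lemma compProd_conditional [IsProbabilityMeasure P] (μ : Measure (EuclideanSpace ℝ (Fin M)))
    [SFinite μ] :
    μ ⊗ₘ conditional K P z
      = (μ.prod (P.map (residual K z))).map (fun p => (p.1, recombine K z p)) := by
  have := isMarkovKernel_conditional (K := K) (P := P) (z := z)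
  have hm := measurable_fst.prodMk (measurable_recombine K z)
  ext s hs
  rw [Measure.compProd_apply hs, Measure.map_apply hm hs, Measure.prod_apply (hm hs)]
  refine lintegral_congr fun y => ?_
  rw [conditional_apply, Measure.map_apply (measurable_recombine_mk K z y)
    (measurable_prodMk_left hs)]
  rfl

/-- Realises Q on a product space with independent inducing values and prior path, so that moments
under Q become moments under a product measure. -/
lemma extend_conditional [IsProbabilityMeasure P] (a : EuclideanSpace ℝ (Fin M))
    (B : Matrix (Fin M) (Fin M) ℝ) :
    extend (conditional K P z) a B
      = ((multivariateGaussian a B).prod P).map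
          (fun p => recombine K z (p.1, residual K z p.2)) := by
  have := isMarkovKernel_conditional (K := K) (P := P) (z := z)
  have hr := measurable_residual K z
  have hm := measurable_fst.prodMk (measurable_recombine K z)
  rw [extend, ← Measure.snd_compProd, compProd_conditional, Measure.snd,
    Measure.map_map measurable_snd hm]
  have h : (multivariateGaussian a B).prod (P.map (residual K z))
      = ((multivariateGaussian a B).prod P).map (Prod.map id (residual K z)) := by
    rw [← Measure.map_prod_map _ _ measurable_id hr, Measure.map_id]
  rw [h, Measure.map_map (measurable_snd.comp hm) (measurable_id.prodMap hr)]
  rfl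

/-- The disintegration is independence together with the identity that recombining f_M with its
residual gives f back. Continuity is dominated convergence, since a recombined value is affine in y.
-/
lemma IsGPLaw.isConditional_conditional (hP : IsGPLaw m K P) (hK : (gram K z).PosDef) :
    IsConditional P z (conditional K P z) := by
  have := hP.gaussian.isProbabilityMeasure
  refine ⟨isMarkovKernel_conditional, ?_, fun n x φ => ?_⟩
  · have hm := measurable_fst.prodMk (measurable_recombine K z)
    rw [compProd_conditional, ← hP.map_evalAt_residual hK, Measure.map_map hm
      ((measurable_evalAt z).prodMk (measurable_residual K z))]
    congr 1
    funext f
    simp only [Function.comp_apply, recombine_evalAt_residual]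
  · have hR := measurable_residual K z
    have : IsProbabilityMeasure (P.map (residual K z)) :=
      Measure.isProbabilityMeasure_map hR.aemeasurable
    have hφ : Measurable fun f : X → ℝ => φ (evalAt x f) :=
      φ.continuous.measurable.comp (measurable_evalAt x)
    have hrec := measurable_recombine_mk K z
    have h (y : EuclideanSpace ℝ (Fin M)) : ∫ f, φ (evalAt x f) ∂(conditional K P z y)
        = ∫ r, φ (evalAt x (recombine K z (y, r))) ∂(P.map (residual K z)) := by
      rw [conditional_apply, integral_map (hrec y).aemeasurable hφ.aestronglyMeasurable]
    simp_rw [h]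
    refine continuous_of_dominated (bound := fun _ => ‖φ‖)
      (fun y => (hφ.comp (hrec y)).aestronglyMeasurable)
      (fun y => .of_forall fun r => φ.norm_coe_le_norm _) (integrable_const _)
      (.of_forall fun r => φ.continuous.comp ?_)
    unfold evalAt recombine dotProduct
    fun_prop

end Conditional

variable {m : X → ℝ} {K : X → X → ℝ} {P : Measure (X → ℝ)} {z : Fin M → X}

/-! ### Laws of f_M under P and Q -/

section Marginals

lemma IsGPLaw.map_evalAt (hP : IsGPLaw m K P) (hK : (gram K z).PosSemidef) :
    P.map (evalAt z) = multivariateGaussian (evalAt z m) (gram K z) := by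
  have hPp := hP.gaussian.isProbabilityMeasure
  have hG : HasGaussianLaw (evalAt z) P := by
    classical
    -- Gaussianity is known for values indexed by finite sets; L passes to the indexed family, in
    -- which points may repeat.
    let L : (Finset.univ.image z → ℝ) →L[ℝ] Fin M → ℝ :=
      ContinuousLinearMap.pi fun i => ContinuousLinearMap.proj ⟨z i, by simp⟩
    have h : HasGaussianLaw (fun (f : X → ℝ) (i : Fin M) => f (z i)) P :=
      (hP.gaussian.hasGaussianLaw (Finset.univ.image z)).map L
    exact h.toLp_pi 2
  have := hG.isGaussian_map
  have hmeas := measurable_evalAt z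
  apply IsGaussian.ext
  · simp only [id_eq, integral_id_multivariateGaussian]
    rw [integral_map hmeas.aemeasurable (by fun_prop)]
    ext i
    have h := ContinuousLinearMap.integral_comp_comm (EuclideanSpace.proj (𝕜 := ℝ) i)
      hG.integrable
    refine h.symm.trans ?_
    exact hP.mean (z i)
  · rw [← ContinuousLinearMap.toBilinForm_inj]
    refine LinearMap.BilinForm.ext_basis (EuclideanSpace.basisFun (Fin M) ℝ).toBasis
      fun i j => ?_
    rw [ContinuousLinearMap.toBilinForm_apply, ContinuousLinearMap.toBilinForm_apply,
      covarianceBilin_apply_eq_cov IsGaussian.memLp_two_id,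
      covarianceBilin_multivariateGaussian hK,
      covariance_map (by fun_prop) (by fun_prop) hmeas.aemeasurable]
    have h (i : Fin M) : (fun u => inner ℝ ((EuclideanSpace.basisFun (Fin M) ℝ).toBasis i) u)
        ∘ evalAt z = fun f : X → ℝ => f (z i) := by
      ext f
      simp [PiLp.inner_apply, evalAt]
    rw [h, h, hP.cov]
    simp [gram]

lemma IsGPLaw.map_evalAt_extend (hP : IsGPLaw m K P) (hK : (gram K z).PosDef)
    (a : EuclideanSpace ℝ (Fin M)) (B : Matrix (Fin M) (Fin M) ℝ) :
    (extend (conditional K P z) a B).map (evalAt z) = multivariateGaussian a B := by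
  have := hP.gaussian.isProbabilityMeasure
  rw [extend_conditional, Measure.map_map (measurable_evalAt z)
    (measurable_recombine_residual K z)]
  have h : evalAt z ∘ (fun p : EuclideanSpace ℝ (Fin M) × (X → ℝ) =>
      recombine K z (p.1, residual K z p.2)) = Prod.fst := by
    funext p
    exact evalAt_recombine_residual hK p.1 p.2
  rw [h]
  exact Measure.fst_prod

end Marginals

/-! ### Q as a Gaussian process -/

section Extension

lemma memLp_dotProduct_multivariateGaussian (a : EuclideanSpace ℝ (Fin M))
    (B : Matrix (Fin M) (Fin M) ℝ) (w : Fin M → ℝ) :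
    MemLp (fun y : EuclideanSpace ℝ (Fin M) => w ⬝ᵥ y.ofLp) 2 (multivariateGaussian a B) :=
  memLp_finsetSum _ fun i _ => (memLp_eval_multivariateGaussian a B i).const_mul (w i)

lemma covariance_dotProduct_multivariateGaussian (a : EuclideanSpace ℝ (Fin M))
    {B : Matrix (Fin M) (Fin M) ℝ} (hB : B.PosSemidef) (w w' : Fin M → ℝ) :
    covariance (fun y : EuclideanSpace ℝ (Fin M) => w ⬝ᵥ y.ofLp) (fun y => w' ⬝ᵥ y.ofLp)
      (multivariateGaussian a B) = w ⬝ᵥ (B *ᵥ w') := by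
  simp only [dotProduct, mulVec]
  rw [covariance_fun_sum_fun_sum
    (fun i => (memLp_eval_multivariateGaussian a B i).const_mul (w i))
    (fun i => (memLp_eval_multivariateGaussian a B i).const_mul (w' i))]
  simp only [covariance_const_mul_left, covariance_const_mul_right,
    covariance_eval_multivariateGaussian hB, Finset.mul_sum]
  exact Finset.sum_congr rfl fun i _ => Finset.sum_congr rfl fun j _ => by ring

lemma IsGPLaw.isGaussianProcess_extend (hP : IsGPLaw m K P) (a : EuclideanSpace ℝ (Fin M))
    (B : Matrix (Fin M) (Fin M) ℝ) :
    IsGaussianProcess (fun (x : X) (f : X → ℝ) => f x)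
      (extend (conditional K P z) a B) := by
  have := hP.gaussian.isProbabilityMeasure
  have hr := measurable_residual K z
  have hT := measurable_recombine_residual K z
  refine ⟨fun I => ⟨?_⟩⟩
  have hI : Measurable (I.restrict : (X → ℝ) → I → ℝ) := by fun_prop
  have h1 : HasGaussianLaw (fun p : EuclideanSpace ℝ (Fin M) × (X → ℝ) => p.1)
      ((multivariateGaussian a B).prod P) := by
    constructor
    have : ((multivariateGaussian a B).prod P).map Prod.fst = multivariateGaussian a B :=
      Measure.fst_prod
    rw [this]
    infer_instance
  have h2 : HasGaussianLaw (fun p : EuclideanSpace ℝ (Fin M) × (X → ℝ) =>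
      I.restrict (residual K z p.2)) ((multivariateGaussian a B).prod P) := by
    constructor
    have h := ((hP.isGaussianProcess_sumElim (z := z)).comp_right Sum.inr).hasGaussianLaw I
    have h3 : ((multivariateGaussian a B).prod P).map Prod.snd = P := Measure.snd_prod
    have h4 : IsGaussian (P.map (I.restrict ∘ residual K z)) := h.isGaussian_map
    rw [← h3, Measure.map_map (hI.comp hr) measurable_snd] at h4
    exact h4
  have h3 := (indepFun_prod (μ := multivariateGaussian a B) (ν := P) measurable_id
    (hI.comp hr)).hasGaussianLaw h1 h2
  -- On the coordinates in I, recombination is the linear map (y, r) ↦ r + w·y, applied to an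
  -- independent and hence jointly Gaussian pair.
  let L : EuclideanSpace ℝ (Fin M) × (I → ℝ) →L[ℝ] I → ℝ :=
    ContinuousLinearMap.snd ℝ _ _ + (ContinuousLinearMap.pi fun x : I =>
      ∑ j, weights K z x j • EuclideanSpace.proj j) ∘L ContinuousLinearMap.fst ℝ _ _
  have h5 := (h3.map L).isGaussian_map
  rw [extend_conditional, Measure.map_map hI hT]
  have h6 : (L ∘ fun p : EuclideanSpace ℝ (Fin M) × (X → ℝ) =>
      (p.1, I.restrict (residual K z p.2)))
      = I.restrict ∘ fun p => recombine K z (p.1, residual K z p.2) := by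
    funext p x
    simp [L, recombine, dotProduct]
  rwa [h6] at h5

lemma IsGPLaw.isGPLaw_extend (hP : IsGPLaw m K P) (hK : (gram K z).PosDef)
    (a : EuclideanSpace ℝ (Fin M)) {B : Matrix (Fin M) (Fin M) ℝ} (hB : B.PosSemidef) :
    IsGPLaw (postMean m K z a) (postCov K z B) (extend (conditional K P z) a B) := by
  have := hP.gaussian.isProbabilityMeasure
  have hT := measurable_recombine_residual K z
  have hw (x : X) := memLp_dotProduct_multivariateGaussian a B (weights K z x)
  have hres (x : X) := hP.memLp_two_residual (z := z) x
  have hGt : (gram K z)⁻¹ᵀ = (gram K z)⁻¹ := by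
    have : (gram K z)ᵀ = gram K z := by
      simpa using hK.1.eq
    rw [transpose_nonsing_inv, this]
  refine ⟨hP.isGaussianProcess_extend a B, fun x => ?_, fun x x' => ?_⟩
  · rw [extend_conditional, integral_map hT.aemeasurable
      (measurable_pi_apply x).aestronglyMeasurable]
    have h1 : ∫ f, residual K z f x ∂P = m x - weights K z x ⬝ᵥ (evalAt z m).ofLp := by
      simp only [residual]
      rw [integral_sub ((hP.memLp_two x).integrable (by norm_num))
        ((hP.memLp_two_dotProduct _).integrable (by norm_num)), hP.mean]
      simp only [dotProduct, evalAt]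
      rw [integral_finsetSum _ fun i _ =>
        ((hP.memLp_two (z i)).integrable (by norm_num)).const_mul _]
      simp_rw [integral_const_mul, hP.mean]
    have h2 : ∫ y, weights K z x ⬝ᵥ y.ofLp ∂(multivariateGaussian a B)
        = weights K z x ⬝ᵥ a.ofLp := by
      simp only [dotProduct]
      rw [integral_finsetSum _ fun i _ =>
        ((memLp_eval_multivariateGaussian a B i).integrable (by norm_num)).const_mul _]
      simp_rw [integral_const_mul, integral_eval_multivariateGaussian]
    simp only [recombine]
    rw [integral_add (((hres x).integrable (by norm_num)).comp_snd _)
      (((hw x).integrable (by norm_num)).comp_fst _), integral_fun_snd (fun f => residual K z f x),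
      integral_fun_fst (fun y : EuclideanSpace ℝ (Fin M) => weights K z x ⬝ᵥ y.ofLp), h1, h2]
    simp only [probReal_univ, one_smul, postMean]
    rw [dotProduct_mulVec]
    simp only [weights, WithLp.ofLp_sub, dotProduct_sub]
    ring
  · rw [extend_conditional, covariance_map_fun (measurable_pi_apply x).aestronglyMeasurable
      (measurable_pi_apply x').aestronglyMeasurable hT.aemeasurable]
    simp only [recombine]
    have hw' (x : X) : MemLp (fun p : EuclideanSpace ℝ (Fin M) × (X → ℝ) =>
        weights K z x ⬝ᵥ p.1.ofLp) 2 ((multivariateGaussian a B).prod P) := (hw x).comp_fst _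
    have hres' (x : X) : MemLp (fun p : EuclideanSpace ℝ (Fin M) × (X → ℝ) =>
        residual K z p.2 x) 2 ((multivariateGaussian a B).prod P) := (hres x).comp_snd _
    have e1 : covariance (fun p : EuclideanSpace ℝ (Fin M) × (X → ℝ) => residual K z p.2 x)
        (fun p => residual K z p.2 x') ((multivariateGaussian a B).prod P)
        = K x x' - weights K z x' ⬝ᵥ kvec K z x := by
      have h3 : ((multivariateGaussian a B).prod P).map Prod.snd = P := Measure.snd_prod
      rw [← hP.covariance_residual hK x x']
      conv_rhs => rw [← h3]
      rw [covariance_map_fun _ _ measurable_snd.aemeasurable]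
      · rw [h3]; exact (hres x).aestronglyMeasurable
      · rw [h3]; exact (hres x').aestronglyMeasurable
    have e2 : covariance (fun p : EuclideanSpace ℝ (Fin M) × (X → ℝ) => weights K z x ⬝ᵥ p.1.ofLp)
        (fun p => weights K z x' ⬝ᵥ p.1.ofLp) ((multivariateGaussian a B).prod P)
        = weights K z x ⬝ᵥ (B *ᵥ weights K z x') := by
      have h3 : ((multivariateGaussian a B).prod P).map Prod.fst = multivariateGaussian a B :=
        Measure.fst_prod
      rw [← covariance_dotProduct_multivariateGaussian a hB]
      conv_rhs => rw [← h3]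
      rw [covariance_map_fun _ _ measurable_fst.aemeasurable]
      · rw [h3]; exact (hw x).aestronglyMeasurable
      · rw [h3]; exact (hw x').aestronglyMeasurable
    -- The cross terms vanish because the two parts live on different factors of the product.
    have e3 (x x' : X) : covariance (fun p : EuclideanSpace ℝ (Fin M) × (X → ℝ) =>
        weights K z x ⬝ᵥ p.1.ofLp) (fun p => residual K z p.2 x')
        ((multivariateGaussian a B).prod P) = 0 :=
      covariance_fst_snd_prod (hw x) (hres x')
    have e4 := e3 x' x
    rw [covariance_comm] at e4
    have h := covariance_add_left (hres' x) (hw' x) ((hres' x').add (hw' x'))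
    rw [covariance_add_right (hres' x) (hres' x') (hw' x'),
      covariance_add_right (hw' x) (hres' x') (hw' x'), e1, e2, e3, e4] at h
    refine h.trans ?_
    have hwx (x : X) : weights K z x = (gram K z)⁻¹ *ᵥ kvec K z x := by
      rw [weights, ← mulVec_transpose, hGt]
    -- The residual contributes K(x, x') - k K_MM⁻¹ k'ᵀ and the inducing part k K_MM⁻¹ B K_MM⁻¹ k'ᵀ.
    -- Since K_MM⁻¹ K_MM K_MM⁻¹ = K_MM⁻¹, they add up to `postCov`.
    have k1 : weights K z x' ⬝ᵥ kvec K z x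
        = kvec K z x ⬝ᵥ ((gram K z)⁻¹ *ᵥ kvec K z x') := by
      rw [hwx, dotProduct_comm]
    have k2 : weights K z x ⬝ᵥ (B *ᵥ weights K z x')
        = kvec K z x ⬝ᵥ (((gram K z)⁻¹ * B * (gram K z)⁻¹) *ᵥ kvec K z x') := by
      rw [hwx x', weights, ← dotProduct_mulVec, mulVec_mulVec, mulVec_mulVec, Matrix.mul_assoc]
    rw [k1, k2, postCov, Matrix.mul_sub, Matrix.sub_mul,
      nonsing_inv_mul _ hK.det_pos.ne'.isUnit, Matrix.one_mul, sub_mulVec, dotProduct_sub]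
    ring

end Extension

end SparseGP

theorem mainTheorem2 {X : Type*} (m : X → ℝ) (K : X → X → ℝ) (P : Measure (X → ℝ))
    (hP : SparseGP.IsGPLaw m K P) (M : ℕ) (z : Fin M → X)
    (hK : (SparseGP.gram K z).PosDef) :
    (∃! κ : Kernel (EuclideanSpace ℝ (Fin M)) (X → ℝ), SparseGP.IsConditional P z κ) ∧
    ∀ κ : Kernel (EuclideanSpace ℝ (Fin M)) (X → ℝ), SparseGP.IsConditional P z κ →
      ∀ (a : EuclideanSpace ℝ (Fin M)) (B : Matrix (Fin M) (Fin M) ℝ), B.PosSemidef →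
        SparseGP.IsGPLaw (SparseGP.postMean m K z a) (SparseGP.postCov K z B)
          (SparseGP.extend κ a B) ∧
        P.map (SparseGP.evalAt z)
          = multivariateGaussian (SparseGP.evalAt z m) (SparseGP.gram K z) ∧
        (SparseGP.extend κ a B).map (SparseGP.evalAt z) = multivariateGaussian a B ∧
        InformationTheory.klDiv (SparseGP.extend κ a B) P
          = InformationTheory.klDiv ((SparseGP.extend κ a B).map (SparseGP.evalAt z))
              (P.map (SparseGP.evalAt z)) ∧
        (B.PosDef →
          InformationTheory.klDiv (SparseGP.extend κ a B) P ≠ ∞ ∧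
          (InformationTheory.klDiv (SparseGP.extend κ a B) P).toReal
            = -(1 / 2) * Real.log (B * (SparseGP.gram K z)⁻¹).det
              + (1 / 2) * (B * (SparseGP.gram K z)⁻¹).trace - (M : ℝ) / 2
              + (1 / 2) * ((a - SparseGP.evalAt z m).ofLp ⬝ᵥ
                  ((SparseGP.gram K z)⁻¹ *ᵥ (a - SparseGP.evalAt z m).ofLp))) ∧
        (¬ B.PosDef → InformationTheory.klDiv (SparseGP.extend κ a B) P = ∞) := by
  have hPp := hP.gaussian.isProbabilityMeasure
  have hPM := hP.map_evalAt hK.posSemidef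
  have hcond := hP.isConditional_conditional hK
  have hopen : (P.map (SparseGP.evalAt z)).IsOpenPosMeasure := by
    rw [hPM]
    exact SparseGP.isOpenPosMeasure_multivariateGaussian _ hK
  refine ⟨⟨_, hcond, fun η hη => hη.unique hcond⟩, fun κ hκ a B hB => ?_⟩
  have hQM : (SparseGP.extend κ a B).map (SparseGP.evalAt z) = multivariateGaussian a B := by
    -- By uniqueness an arbitrary κ is Matheron's kernel, for which the laws have been computed.
    rw [hκ.unique hcond]
    exact hP.map_evalAt_extend hK a B
  have hkl := SparseGP.klDiv_extend_eq hκ a B hQM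
  refine ⟨?_, hPM, hQM, hkl, fun hB' => ?_, fun hB' => ?_⟩
  · rw [hκ.unique hcond]
    exact hP.isGPLaw_extend hK a hB
  · rw [hkl, hQM, hPM]
    simpa using SparseGP.klDiv_multivariateGaussian a (SparseGP.evalAt z m) hB' hK
  · rw [hkl, hQM, hPM]
    exact InformationTheory.klDiv_of_not_ac
      (SparseGP.not_absolutelyContinuous_of_not_posDef a _ hB hB' hK)
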